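/- For a real number $x$ and an integer $k\ge 0$ let $\binom{x}{k}=x(x-1)\cdots(x-k+1)/k!$ if $x\ge k-1$, and $\binom{x}{k}=0$ if $x<k-1$. Let $t\ge q>i\ge 1$ be integers. Let $\mathcal H$ be a $q$-uniform hypergraph on a finite vertex set $V$ with $|V|=n$. The degree $d(I)$ of $I\subseteq V$ is the number of edges containing $I$, and a $t$-clique is a $t$-subset of $V$ all of whose $q$-subsets are edges. For each $i$-subset $I$ of $V$ let $x(I)\ge q-i-1$ be a real number with $d(I)=\binom{x(I)-i}{q-i}$. Such a number always exists, and it is unique whenever $d(I)>0$. For each $t$-clique $T$ put $$x(T)=\max\{x(I): I\subseteq T,\ |I|=i\},\qquad s(T)=\frac{1}{\binom{x(T)-i}{t-i}}.$$ Then $x(T)$ does not depend on the choice of the numbers $x(I)$, and $x(T)\ge t$ for every $t$-clique $T$. For real $y\ge t$ we have $\binom{y-i}{t-i}>0$, so $s(T)$ is well-defined, and $1/\binom{y-i}{t-i}$ is strictly decreasing in $y$ on $[t,\infty)$. Moreover, $$\sum_{T} s(T)\le\frac{\binom{n}{i}}{\binom{t}{i}},$$ where the sum is over all $t$-cliques $T$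 of $\mathcal H$. For every choice of $t\ge q>i\ge1$ there is an infinite family of hypergraphs attaining the bound: there are infinitely many $n$ for which some $q$-uniform hypergraph on $n$ vertices satisfies it with equality. In particular, equality holds for the $q$-shadow (the hypergraph of all $q$-sets contained in some block) of every Steiner system $S(i,r,n)$ with $r\ge t$, that is, of every family of $r$-subsets (blocks) of an $n$-set such that each $i$-subset lies in exactly one block. -/

import Mathlib

/-- The generalized binomial coefficient `binom(x, k)` of a real `x` and a natural number `k`:
`x (x - 1) ⋯ (x - k + 1) / k!` if `x ≥ k - 1`, and `0` if `x < k - 1`. -/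
noncomputable def genBinom (x : ℝ) (k : ℕ) : ℝ :=
  open Classical in
  if (k : ℝ) - 1 ≤ x then (∏ j ∈ Finset.range k, (x - j)) / (k.factorial : ℝ) else 0

/-- A `q`-uniform hypergraph on the vertex set `V`. -/
structure UniformHypergraph (V : Type*) (q : ℕ) where
  edges : Finset (Finset V)
  uniform : ∀ e ∈ edges, e.card = q

namespace UniformHypergraph

variable {V : Type*} [DecidableEq V] {q : ℕ}

/-- The degree `d(I)`: the number of edges that contain `I`. -/
def degree (H : UniformHypergraph V q) (I : Finset V) : ℕ :=
  (H.edges.filter fun e => I ⊆ e).card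

/-- The set of `t`-cliques: the `t`-sets of vertices all of whose `q`-subsets are edges. -/
def cliques [Fintype V] (H : UniformHypergraph V q) (t : ℕ) : Finset (Finset V) :=
  (Finset.univ.powersetCard t).filter fun T => T.powersetCard q ⊆ H.edges

/-- The real number `y` is a possible value of `x(I)`, for a vertex set `I` of size `i`:
`y ≥ q - i - 1` and `d(I) = binom(y - i, q - i)`. -/
def IsDegreeParam (H : UniformHypergraph V q) (i : ℕ) (I : Finset V) (y : ℝ) : Prop :=
  (q : ℝ) - i - 1 ≤ y ∧ (H.degree I : ℝ) = genBinom (y - i) (q - i)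

/-- `x` assigns to every `i`-set `I` of vertices a number `x(I)` as above
(its values on other sets are irrelevant). -/
def IsDegreeFunction (H : UniformHypergraph V q) (i : ℕ) (x : Finset V → ℝ) : Prop :=
  ∀ I : Finset V, I.card = i → H.IsDegreeParam i I (x I)

end UniformHypergraph

/-- `x(T)`: the maximum of `x(I)` over the `i`-subsets `I` of `T`
(`0` if there are none, that is, if `T` has fewer than `i` elements). -/
noncomputable def maxOverSubsets {V : Type*} (i : ℕ) (x : Finset V → ℝ) (T : Finset V) : ℝ :=
  open Classical in
  if h : (T.powersetCard i).Nonempty then (T.powersetCard i).sup' h x else 0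

/-- The weight `1 / binom(y - i, t - i)` of a `t`-clique `T` with `x(T) = y`. -/
noncomputable def cliqueWeight (i t : ℕ) (y : ℝ) : ℝ :=
  1 / genBinom (y - i) (t - i)

/-- `H` attains the bound: the total weight of its `t`-cliques is exactly
`binom(n, i) / binom(t, i)`. -/
def UniformHypergraph.AttainsBound {V : Type*} [DecidableEq V] [Fintype V] {q : ℕ}
    (H : UniformHypergraph V q) (i t : ℕ) : Prop :=
  ∀ x : Finset V → ℝ, H.IsDegreeFunction i x →
    ∑ T ∈ H.cliques t, cliqueWeight i t (maxOverSubsets i x T) =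
      ((Fintype.card V).choose i : ℝ) / (t.choose i : ℝ)

/-- A Steiner system `S(i, r, n)` on the `n`-set `V`: a family of `r`-subsets (blocks) such that
every `i`-subset lies in exactly one block. -/
def IsSteinerSystem {V : Type*} (i r : ℕ) (B : Finset (Finset V)) : Prop :=
  (∀ b ∈ B, b.card = r) ∧ ∀ I : Finset V, I.card = i → ∃! b, b ∈ B ∧ I ⊆ b

/-- The `q`-shadow of a set system: the hypergraph whose edges are the `q`-subsets of its
members. -/
def qShadow {V : Type*} [DecidableEq V] (q : ℕ) (B : Finset (Finset V)) :
    UniformHypergraph V q where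
  edges := B.biUnion fun b => b.powersetCard q
  uniform := by
    intro e he
    obtain ⟨b, -, hb⟩ := Finset.mem_biUnion.1 he
    exact (Finset.mem_powersetCard.1 hb).2

/-! ### The generalized binomial coefficient -/

/-! The proof is a weighted double count of pairs `I ⊆ T`. Deleting `I` from the edges containing it
leaves a `(q - i)`-uniform family of size binom(x(I) - i, q - i). The cliques through `I` become `(t
- i)`-sets all of whose `(q - i)`-subsets lie in that family, so Kruskal–Katona in Lovász's form
(`card_le_genBinom`) bounds their number by binom(x(I) - i, t - i). If each clique through `I` gets
weight 1 / binom(x(I) - i, t - i), the total at `I` is thus at most 1. The weight decreases in `y`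
and x(I) ≤ x(T), so binom(t, i) s(T) is at most the sum of these weights over `I ⊆ T`; summing over
`T` and exchanging sums gives the bound.

In the shadow of a Steiner system every x(I) equals `r` and the cliques are the `t`-subsets of
blocks, so every inequality is tight. A single block gives the infinite family. -/

theorem genBinom_of_le {x : ℝ} {k : ℕ} (h : (k : ℝ) - 1 ≤ x) :
    genBinom x k = (∏ j ∈ Finset.range k, (x - j)) / (k.factorial : ℝ) := by
  simp [genBinom, h]

theorem genBinom_of_lt {x : ℝ} {k : ℕ} (h : x < (k : ℝ) - 1) : genBinom x k = 0 := by
  simp [genBinom, not_le.2 h]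

theorem genBinom_zero_right {x : ℝ} (h : -1 ≤ x) : genBinom x 0 = 1 := by
  rw [genBinom_of_le (by simpa using h)]; simp

theorem sub_nonneg_of_mem_range {x : ℝ} {k j : ℕ} (h : (k : ℝ) - 1 ≤ x)
    (hj : j ∈ Finset.range k) : 0 ≤ x - j := by
  have : (j : ℝ) + 1 ≤ k := by exact_mod_cast Finset.mem_range.1 hj
  linarith

theorem genBinom_nonneg (x : ℝ) (k : ℕ) : 0 ≤ genBinom x k := by
  rcases le_or_gt ((k : ℝ) - 1) x with h | h
  · rw [genBinom_of_le h]
    exact div_nonneg (Finset.prod_nonneg fun j hj => sub_nonneg_of_mem_range h hj) (by positivity)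
  · rw [genBinom_of_lt h]

theorem genBinom_pos {x : ℝ} {k : ℕ} (h : (k : ℝ) - 1 < x) : 0 < genBinom x k := by
  rw [genBinom_of_le h.le]
  refine div_pos (Finset.prod_pos fun j hj => ?_) (by positivity)
  have : (j : ℝ) + 1 ≤ k := by exact_mod_cast Finset.mem_range.1 hj
  linarith

theorem genBinom_mono (k : ℕ) : Monotone fun x => genBinom x k := by
  intro x y hxy
  dsimp only
  rcases le_or_gt ((k : ℝ) - 1) x with h | h
  · rw [genBinom_of_le h, genBinom_of_le (h.trans hxy)]
    gcongr with j hj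
    exact fun j hj => sub_nonneg_of_mem_range h hj
  · rw [genBinom_of_lt h]
    exact genBinom_nonneg y k

theorem genBinom_strictMonoOn {k : ℕ} (hk : 1 ≤ k) :
    StrictMonoOn (fun x => genBinom x k) (Set.Ici ((k : ℝ) - 1)) := by
  intro x hx y hy hxy
  dsimp only
  have hx' : (k : ℝ) - 1 ≤ x := hx
  rw [genBinom_of_le hx, genBinom_of_le hy]
  refine div_lt_div_of_pos_right ?_ (by positivity)
  obtain ⟨k, rfl⟩ := Nat.exists_eq_add_of_le' hk
  rw [Finset.prod_range_succ, Finset.prod_range_succ]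
  have hpos : ∀ j ∈ Finset.range k, 0 < y - (j : ℝ) := by
    intro j hj
    have : (j : ℝ) + 1 ≤ k := by exact_mod_cast Finset.mem_range.1 hj
    push_cast at hx'
    linarith
  -- Strictness comes from the last factor, since `x - k` may vanish while the other factors stay
  -- positive at `y`.
  refine mul_lt_mul' ?_ (by linarith) ?_ (Finset.prod_pos hpos)
  · refine Finset.prod_le_prod (fun j hj => ?_) fun j _ => by linarith
    exact sub_nonneg_of_mem_range hx'
      (Finset.mem_range.2 ((Finset.mem_range.1 hj).trans k.lt_succ_self))
  · push_cast at hx'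
    linarith

theorem genBinom_succ_mul {x : ℝ} {k : ℕ} (h : (k : ℝ) ≤ x) :
    genBinom x (k + 1) * (k + 1) = genBinom x k * (x - k) := by
  rw [genBinom_of_le (by push_cast; linarith), genBinom_of_le (by linarith),
    Finset.prod_range_succ, Nat.factorial_succ]
  push_cast
  field_simp

theorem genBinom_succ_mul' {x : ℝ} {k : ℕ} (h : (k : ℝ) ≤ x) :
    genBinom x (k + 1) * (k + 1) = x * genBinom (x - 1) k := by
  rw [genBinom_of_le (by push_cast; linarith), genBinom_of_le (by linarith),
    Finset.prod_range_succ', Nat.factorial_succ]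
  have : ∀ j ∈ Finset.range k, x - ((j + 1 : ℕ) : ℝ) = x - 1 - j := fun j _ => by push_cast; ring
  rw [Finset.prod_congr rfl this]
  push_cast
  field_simp
  ring

theorem genBinom_natCast (n k : ℕ) : genBinom n k = n.choose k := by
  rcases le_or_gt ((k : ℝ) - 1) n with h | h
  · rw [genBinom_of_le h, Nat.cast_choose_eq_descPochhammer_div,
      descPochhammer_eval_eq_prod_range]
  · rw [genBinom_of_lt h, Nat.choose_eq_zero_of_lt, Nat.cast_zero]
    have : (n : ℝ) < k := by linarith
    exact_mod_cast this

theorem genBinom_self (k : ℕ) : genBinom k k = 1 := by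
  simp [genBinom_natCast]

/-- Intermediate value theorem on `[k - 1, k - 1 + N]`: the value is 0 at the left end and, by
Pascal's rule, at least `N` at the right end. -/
theorem exists_genBinom_eq {k : ℕ} (hk : 1 ≤ k) (N : ℕ) :
    ∃ x : ℝ, (k : ℝ) - 1 ≤ x ∧ genBinom x k = N := by
  have hcont : ContinuousOn (fun x => genBinom x k)
      (Set.Icc ((k : ℝ) - 1) (((k - 1 + N : ℕ)) : ℝ)) := by
    have h : ContinuousOn (fun x : ℝ => (∏ j ∈ Finset.range k, (x - (j : ℝ))) / (k.factorial : ℝ))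
        (Set.Icc ((k : ℝ) - 1) (((k - 1 + N : ℕ)) : ℝ)) := by fun_prop
    exact h.congr fun x hx => genBinom_of_le hx.1
  have hk' : ((k - 1 : ℕ) : ℝ) = (k : ℝ) - 1 := by push_cast [hk]; ring
  have hle : (k : ℝ) - 1 ≤ ((k - 1 + N : ℕ) : ℝ) := by
    rw [← hk']; exact_mod_cast Nat.le_add_right _ _
  have hN : (N : ℝ) ≤ genBinom ((k - 1 + N : ℕ) : ℝ) k := by
    rw [genBinom_natCast]
    norm_cast
    obtain ⟨k, rfl⟩ := Nat.exists_eq_add_of_le' hk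
    rw [Nat.add_sub_cancel]
    clear hle hcont hk'
    induction N with
    | zero => simp
    | succ N ih =>
      rw [← Nat.add_assoc, Nat.choose_succ_succ, Nat.add_comm N]
      exact Nat.add_le_add (Nat.choose_pos (Nat.le_add_right _ _)) ih
  have h0 : genBinom ((k : ℝ) - 1) k ≤ N := by
    rw [← hk', genBinom_natCast, Nat.choose_eq_zero_of_lt (by omega)]
    simp
  obtain ⟨x, hx, hxN⟩ := intermediate_value_Icc hle hcont ⟨h0, hN⟩
  exact ⟨x, hx.1, hxN⟩

theorem le_of_one_le_genBinom {x : ℝ} {k : ℕ} (hk : 1 ≤ k) (h : 1 ≤ genBinom x k) :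
    (k : ℝ) ≤ x := by
  by_contra! hx
  rcases le_or_gt ((k : ℝ) - 1) x with h' | h'
  · have := genBinom_strictMonoOn hk (Set.mem_Ici.2 h') (Set.mem_Ici.2 (by linarith)) hx
    simp only [genBinom_self] at this
    linarith
  · rw [genBinom_of_lt h'] at h
    norm_num at h

/-- A value of at least 1 keeps both arguments off the flat zero part, where monotonicity cannot be
inverted. -/
theorem le_of_genBinom_le {x y : ℝ} {k : ℕ} (hk : 1 ≤ k) (hx : 1 ≤ genBinom x k)
    (h : genBinom x k ≤ genBinom y k) : x ≤ y := by
  have hx' := le_of_one_le_genBinom hk hx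
  have hy' := le_of_one_le_genBinom hk (hx.trans h)
  exact ((genBinom_strictMonoOn hk).le_iff_le (Set.mem_Ici.2 (by linarith))
    (Set.mem_Ici.2 (by linarith))).1 h

/-! ### The Kruskal–Katona theorem in Lovász's form -/

open Finset in
theorem sum_card_memberSubfamily {V : Type*} [DecidableEq V] [Fintype V] {k : ℕ}
    {A : Finset (Finset V)} (hA : ∀ s ∈ A, s.card = k) :
    ∑ v, (A.memberSubfamily v).card = A.card * k := by
  have h1 : ∀ v, (A.memberSubfamily v).card = ∑ s ∈ A, if v ∈ s then 1 else 0 := by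
    intro v
    rw [memberSubfamily, card_image_of_injOn, card_filter]
    intro s hs s' hs' h
    simp only [coe_filter, Set.mem_ofPred_eq] at hs hs'
    dsimp only at h
    rw [← insert_erase hs.2, h, insert_erase hs'.2]
  simp_rw [h1]
  rw [sum_comm, sum_congr rfl (g := fun _ => k), sum_const, smul_eq_mul]
  intro s hs
  simp [hA s hs]

/-- The averaging step: local bounds on the links give the global bound. -/
theorem card_le_genBinom_of_links {V : Type*} [DecidableEq V] [Fintype V] {k : ℕ}
    {G K : Finset (Finset V)} {x : ℝ} (hG : ∀ e ∈ G, e.card = k + 1)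
    (hK : ∀ s ∈ K, s.card = k + 2) (hx : ((k + 1 : ℕ) : ℝ) ≤ x)
    (hcard : (G.card : ℝ) = genBinom x (k + 1))
    (h : ∀ v, ((K.memberSubfamily v).card : ℝ) * (k + 1) ≤
      (x - (k + 1)) * (G.memberSubfamily v).card) :
    (K.card : ℝ) ≤ genBinom x (k + 2) := by
  -- Summed over `v`, the links count each member of `K` `k + 2` times and each member of `G` `k +
  -- 1` times.
  have hsum := Finset.sum_le_sum fun v (_ : v ∈ Finset.univ) => h v
  rw [← Finset.sum_mul, ← Finset.mul_sum] at hsum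
  have h1 : ∑ v, ((K.memberSubfamily v).card : ℝ) = K.card * ((k : ℝ) + 2) := by
    exact_mod_cast sum_card_memberSubfamily hK
  have h2 : ∑ v, ((G.memberSubfamily v).card : ℝ) = G.card * ((k : ℝ) + 1) := by
    exact_mod_cast sum_card_memberSubfamily hG
  rw [h1, h2] at hsum
  have h3 := genBinom_succ_mul hx
  push_cast at h3
  rw [hcard] at hsum
  have hk : (0 : ℝ) < (k + 1) * (k + 2) := by positivity
  refine le_of_mul_le_mul_right ?_ hk
  linear_combination hsum - (k + 1) * h3

/-- A link with at least `binom(x - 1, k)` members satisfies the local bound. -/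
theorem card_memberSubfamily_mul_le {V : Type*} [DecidableEq V] {k : ℕ}
    {G K : Finset (Finset V)} {x : ℝ} (hK : ∀ s ∈ K, s.card = k + 2)
    (hGK : ∀ s ∈ K, s.powersetCard (k + 1) ⊆ G) (hx : ((k + 1 : ℕ) : ℝ) ≤ x)
    (hcard : (G.card : ℝ) = genBinom x (k + 1)) (v : V)
    (hv : genBinom (x - 1) k ≤ (G.memberSubfamily v).card) :
    ((K.memberSubfamily v).card : ℝ) * (k + 1) ≤ (x - (k + 1)) * (G.memberSubfamily v).card := by
  -- If `s ∪ {v}` is in `K` then `s`, one element smaller, is in `G` and avoids `v`.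
  have hsub : K.memberSubfamily v ⊆ G.nonMemberSubfamily v := by
    intro s hs
    rw [Finset.mem_memberSubfamily] at hs
    refine Finset.mem_nonMemberSubfamily.2 ⟨hGK _ hs.1 ?_, hs.2⟩
    have := hK _ hs.1
    rw [Finset.card_insert_of_notMem hs.2] at this
    exact Finset.mem_powersetCard.2 ⟨Finset.subset_insert _ _, by omega⟩
  have h1 : ((K.memberSubfamily v).card : ℝ) + (G.memberSubfamily v).card ≤ G.card := by
    rw [← Finset.card_memberSubfamily_add_card_nonMemberSubfamily v G]
    have : ((K.memberSubfamily v).card : ℝ) ≤ (G.nonMemberSubfamily v).card := by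
      exact_mod_cast Finset.card_le_card hsub
    push_cast
    linarith
  push_cast at hx
  -- Since (k + 1)|G| = x binom(x - 1, k), the hypothesis on the link gives (k + 1)|G| ≤ x |G_v|.
  have h2 := genBinom_succ_mul' (x := x) (k := k) (by linarith)
  have h3 : x * genBinom (x - 1) k ≤ x * (G.memberSubfamily v).card :=
    mul_le_mul_of_nonneg_left hv (by linarith [(k.cast_nonneg : (0 : ℝ) ≤ k)])
  have h4 := mul_le_mul_of_nonneg_right h1 (by positivity : (0 : ℝ) ≤ k + 1)
  rw [hcard, h2] at h4
  linarith

/-- If every `(k+1)`-subset of a member of `K` lies in `G`, then `|G| = binom(x, k+1)` implies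
`|K| ≤ binom(x, k+2)`. -/
theorem card_le_genBinom_succ {V : Type*} [DecidableEq V] [Fintype V] (k : ℕ) :
    ∀ (G K : Finset (Finset V)) (x : ℝ), (∀ e ∈ G, e.card = k + 1) →
      (∀ s ∈ K, s.card = k + 2) → (∀ s ∈ K, s.powersetCard (k + 1) ⊆ G) →
      ((k + 1 : ℕ) : ℝ) ≤ x → (G.card : ℝ) = genBinom x (k + 1) →
      (K.card : ℝ) ≤ genBinom x (k + 2) := by
  induction k with
  | zero =>
    intro G K x hG hK hGK hx hcard
    refine card_le_genBinom_of_links hG hK hx hcard fun v => ?_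
    rcases (K.memberSubfamily v).eq_empty_or_nonempty with hv | ⟨s, hs⟩
    · rw [hv]
      simp only [Finset.card_empty, Nat.cast_zero, zero_mul]
      exact mul_nonneg (by push_cast at hx ⊢; linarith) (Nat.cast_nonneg _)
    · refine card_memberSubfamily_mul_le hK hGK hx hcard v ?_
      -- For `k = 0` the threshold is 1, and a nonempty link of `K` already forces `{v} ∈ G`.
      rw [genBinom_zero_right (by push_cast at hx; linarith)]
      norm_cast
      refine Finset.card_pos.2 ⟨∅, ?_⟩
      rw [Finset.mem_memberSubfamily] at hs ⊢
      exact ⟨hGK _ hs.1 (by simp [Finset.mem_powersetCard]), by simp⟩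
  | succ k ih =>
    intro G K x hG hK hGK hx hcard
    refine card_le_genBinom_of_links hG hK hx hcard fun v => ?_
    rcases le_or_gt (genBinom (x - 1) (k + 1)) (G.memberSubfamily v).card with hv | hv
    · exact card_memberSubfamily_mul_le hK hGK hx hcard v hv
    have hK' : ∀ s ∈ K.memberSubfamily v, s.card = k + 2 := by
      intro s hs
      rw [Finset.mem_memberSubfamily] at hs
      have := hK _ hs.1
      rw [Finset.card_insert_of_notMem hs.2] at this
      omega
    have hGK' : ∀ s ∈ K.memberSubfamily v, s.powersetCard (k + 1) ⊆ G.memberSubfamily v := by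
      intro s hs e he
      rw [Finset.mem_memberSubfamily] at hs ⊢
      rw [Finset.mem_powersetCard] at he
      have hve : v ∉ e := fun h => hs.2 (he.1 h)
      refine ⟨hGK _ hs.1 (Finset.mem_powersetCard.2 ⟨Finset.insert_subset_insert _ he.1, ?_⟩), hve⟩
      rw [Finset.card_insert_of_notMem hve, he.2]
    have hG' : ∀ e ∈ G.memberSubfamily v, e.card = k + 1 := by
      intro e he
      rw [Finset.mem_memberSubfamily] at he
      have := hG _ he.1
      rw [Finset.card_insert_of_notMem he.2] at this
      omega
    push_cast at hx ⊢
    rcases (K.memberSubfamily v).eq_empty_or_nonempty with hKv | ⟨s, hs⟩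
    · rw [hKv]
      simp only [Finset.card_empty, Nat.cast_zero, zero_mul]
      exact mul_nonneg (by linarith) (Nat.cast_nonneg _)
    -- A small link has size binom(z, k + 1) with `z ≤ x - 1`; induction inside the link then gives
    -- the local bound.
    obtain ⟨z, -, hz⟩ := exists_genBinom_eq (k := k + 1) (by omega) (G.memberSubfamily v).card
    have h1 : 1 ≤ genBinom z (k + 1) := by
      rw [hz]
      obtain ⟨e, he⟩ := Finset.powersetCard_nonempty.2 (show k + 1 ≤ s.card by rw [hK' s hs]; omega)
      exact_mod_cast Finset.card_pos.2 ⟨e, hGK' s hs he⟩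
    have hkz := le_of_one_le_genBinom (by omega) h1
    have hzx : z ≤ x - 1 := le_of_genBinom_le (by omega) h1 (hz ▸ hv.le)
    have h2 := ih _ _ z hG' hK' hGK' hkz hz.symm
    have h3 := genBinom_succ_mul hkz
    push_cast at h3
    rw [hz] at h3
    have h4 : ((K.memberSubfamily v).card : ℝ) * (k + 1 + 1) ≤
        genBinom z (k + 2) * (k + 1 + 1) := by gcongr
    have h5 : ((G.memberSubfamily v).card : ℝ) * (z - (k + 1)) ≤
        (G.memberSubfamily v).card * (x - (k + 1 + 1)) := by gcongr ?_ * ?_; linarith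
    linarith

/-- If every `m`-subset of a member of `K` lies in `G`, then `|G| = binom(x, m)` implies
`|K| ≤ binom(x, t)`, where `G` consists of `m`-sets and `K` of `t`-sets. -/
theorem card_le_genBinom {V : Type*} [DecidableEq V] [Fintype V] {m t : ℕ} (hm : 1 ≤ m)
    (hmt : m ≤ t) {G : Finset (Finset V)} {x : ℝ}
    (hcard : (G.card : ℝ) = genBinom x m) :
    ∀ K : Finset (Finset V), (∀ s ∈ K, s.card = t) → (∀ s ∈ K, s.powersetCard m ⊆ G) →
      (K.card : ℝ) ≤ genBinom x t := by
  induction t, hmt using Nat.le_induction with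
  | base =>
    intro K hK hGK
    rw [← hcard]
    norm_cast
    exact Finset.card_le_card fun s hs =>
      hGK s hs (Finset.mem_powersetCard.2 ⟨subset_rfl, hK s hs⟩)
  | succ t hmt ih =>
    intro K hK hGK
    obtain ⟨k, rfl⟩ := Nat.exists_eq_add_of_le' (hm.trans hmt)
    rcases K.eq_empty_or_nonempty with rfl | ⟨s, hs⟩
    · simpa using genBinom_nonneg x _
    -- `L` is the largest admissible family one level below `K`: the induction hypothesis bounds it
    -- by `x`, and one step up from `L` bounds `K`.
    set L : Finset (Finset V) :=
      (Finset.univ.powersetCard (k + 1)).filter fun T => T.powersetCard m ⊆ G with hL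
    have hLcard : ∀ T ∈ L, T.card = k + 1 := fun T hT =>
      (Finset.mem_powersetCard.1 (Finset.mem_filter.1 hT).1).2
    have hKL : ∀ s ∈ K, s.powersetCard (k + 1) ⊆ L := by
      intro s hs T hT
      rw [Finset.mem_powersetCard] at hT
      refine Finset.mem_filter.2 ⟨Finset.mem_powersetCard.2 ⟨Finset.subset_univ _, hT.2⟩, ?_⟩
      exact (Finset.powersetCard_mono hT.1).trans (hGK s hs)
    obtain ⟨z, -, hz⟩ := exists_genBinom_eq (k := k + 1) (by omega) L.card
    have h1 : 1 ≤ genBinom z (k + 1) := by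
      rw [hz]
      obtain ⟨T, hT⟩ := Finset.powersetCard_nonempty.2 (show k + 1 ≤ s.card by rw [hK s hs]; omega)
      exact_mod_cast Finset.card_pos.2 ⟨T, hKL s hs hT⟩
    have hLx := ih L hLcard fun T hT => (Finset.mem_filter.1 hT).2
    have hzx : z ≤ x := le_of_genBinom_le (by omega) h1 (hz ▸ hLx)
    exact (card_le_genBinom_succ k L K z hLcard hK hKL
      (le_of_one_le_genBinom (by omega) h1) hz.symm).trans (genBinom_mono _ hzx)

/-! ### Double counting -/

theorem sum_sum_powersetCard {V : Type*} [DecidableEq V] [Fintype V] (i : ℕ)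
    (C : Finset (Finset V)) (f : Finset V → ℝ) :
    ∑ T ∈ C, ∑ I ∈ T.powersetCard i, f I =
      ∑ I ∈ Finset.univ.powersetCard i, ((C.filter fun T => I ⊆ T).card : ℝ) * f I := by
  rw [Finset.sum_comm' (t' := Finset.univ.powersetCard i) (s' := fun I => C.filter fun T => I ⊆ T)]
  · simp
  · intro T I
    simp only [Finset.mem_powersetCard, Finset.mem_filter, Finset.subset_univ, true_and]
    tauto

/-! ### The weight of a clique -/

theorem genBinom_sub_pos {i t : ℕ} (hit : i ≤ t) {y : ℝ} (hy : (t : ℝ) ≤ y) :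
    0 < genBinom (y - i) (t - i) :=
  genBinom_pos (by push_cast [hit]; linarith)

theorem cliqueWeight_strictAntiOn {i t : ℕ} (hit : i < t) :
    StrictAntiOn (cliqueWeight i t) (Set.Ici (t : ℝ)) := by
  intro y hy z hz hyz
  rw [Set.mem_Ici] at hy hz
  have hmem : ∀ w : ℝ, (t : ℝ) ≤ w → w - i ∈ Set.Ici (((t - i : ℕ) : ℝ) - 1) := fun w hw => by
    rw [Set.mem_Ici]; push_cast [hit.le]; linarith
  exact one_div_lt_one_div_of_lt (genBinom_sub_pos hit.le hy)
    (genBinom_strictMonoOn (by omega) (hmem y hy) (hmem z hz) (by linarith))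

theorem maxOverSubsets_eq_sup' {V : Type*} {i : ℕ} {T : Finset V}
    (h : (T.powersetCard i).Nonempty) (x : Finset V → ℝ) :
    maxOverSubsets i x T = (T.powersetCard i).sup' h x := by
  simp [maxOverSubsets, h]

theorem le_maxOverSubsets {V : Type*} {i : ℕ} {T I : Finset V} (hI : I ∈ T.powersetCard i)
    (x : Finset V → ℝ) : x I ≤ maxOverSubsets i x T := by
  rw [maxOverSubsets_eq_sup' ⟨I, hI⟩]
  exact Finset.le_sup' x hI

theorem maxOverSubsets_congr {V : Type*} {i : ℕ} {T : Finset V} {x x' : Finset V → ℝ}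
    (h : ∀ I ∈ T.powersetCard i, x I = x' I) : maxOverSubsets i x T = maxOverSubsets i x' T := by
  by_cases hT : (T.powersetCard i).Nonempty
  · rw [maxOverSubsets_eq_sup' hT, maxOverSubsets_eq_sup' hT]
    exact Finset.sup'_congr hT rfl h
  · simp [maxOverSubsets, hT]

theorem maxOverSubsets_eq_of_forall {V : Type*} {i : ℕ} {T : Finset V} {x : Finset V → ℝ} {c : ℝ}
    (hT : i ≤ T.card) (h : ∀ I ∈ T.powersetCard i, x I = c) : maxOverSubsets i x T = c := by
  have hne := Finset.powersetCard_nonempty.2 hT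
  rw [maxOverSubsets_eq_sup' hne, Finset.sup'_congr hne rfl h, Finset.sup'_const]

/-! ### Degrees and cliques -/

namespace UniformHypergraph

variable {V : Type*} [DecidableEq V] {q : ℕ}

theorem exists_isDegreeParam {i : ℕ} (hiq : i < q) (H : UniformHypergraph V q) (I : Finset V) :
    ∃ y : ℝ, H.IsDegreeParam i I y := by
  obtain ⟨z, hz, h⟩ := exists_genBinom_eq (k := q - i) (by omega) (H.degree I)
  push_cast [hiq.le] at hz
  refine ⟨z + i, ?_, ?_⟩
  · linarith [(i.cast_nonneg : (0 : ℝ) ≤ i)]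
  · rw [add_sub_cancel_right, h]

theorem IsDegreeParam.eq {i : ℕ} (hiq : i < q) {H : UniformHypergraph V q} {I : Finset V}
    (hd : 0 < H.degree I) {y z : ℝ} (hy : H.IsDegreeParam i I y) (hz : H.IsDegreeParam i I z) :
    y = z := by
  have hd' : (1 : ℝ) ≤ H.degree I := by exact_mod_cast hd
  have h1 : y - i ≤ z - i :=
    le_of_genBinom_le (k := q - i) (by omega) (hy.2 ▸ hd') (hy.2 ▸ hz.2 ▸ le_rfl)
  have h2 : z - i ≤ y - i :=
    le_of_genBinom_le (k := q - i) (by omega) (hz.2 ▸ hd') (hy.2 ▸ hz.2 ▸ le_rfl)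
  linarith

variable [Fintype V]

theorem mem_cliques {H : UniformHypergraph V q} {t : ℕ} {T : Finset V} :
    T ∈ H.cliques t ↔ T.card = t ∧ ∀ e ⊆ T, e.card = q → e ∈ H.edges := by
  simp only [cliques, Finset.mem_filter, Finset.mem_powersetCard, Finset.subset_univ, true_and,
    Finset.subset_iff (s₁ := T.powersetCard q), and_imp]

theorem choose_le_degree {H : UniformHypergraph V q} {t i : ℕ} (hiq : i < q) {T I : Finset V}
    (hT : T ∈ H.cliques t) (hI : I ∈ T.powersetCard i) :
    (t - i).choose (q - i) ≤ H.degree I := by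
  rw [Finset.mem_powersetCard] at hI
  rw [mem_cliques] at hT
  rw [← hT.1, ← hI.2, ← Finset.card_filter_powersetCard_subset _ _ _ hI.1 (hI.2.le.trans hiq.le)]
  refine Finset.card_le_card fun e he => ?_
  rw [Finset.mem_filter, Finset.mem_powersetCard] at he
  exact Finset.mem_filter.2 ⟨hT.2 e he.1.1 he.1.2, he.2⟩

theorem degree_pos {H : UniformHypergraph V q} {t i : ℕ} (hiq : i < q) (hqt : q ≤ t)
    {T I : Finset V} (hT : T ∈ H.cliques t) (hI : I ∈ T.powersetCard i) : 0 < H.degree I :=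
  (Nat.choose_pos (by omega)).trans_le (choose_le_degree hiq hT hI)

/-- The `q`-subsets of `T` through `I` already give `I` degree binom(t - i, q - i), the value at `y
= t`. -/
theorem IsDegreeParam.le {H : UniformHypergraph V q} {t i : ℕ} (hiq : i < q) (hqt : q ≤ t)
    {T I : Finset V} (hT : T ∈ H.cliques t) (hI : I ∈ T.powersetCard i) {y : ℝ}
    (hy : H.IsDegreeParam i I y) : (t : ℝ) ≤ y := by
  have h : (((t - i).choose (q - i) : ℕ) : ℝ) ≤ H.degree I := by
    exact_mod_cast choose_le_degree hiq hT hI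
  rw [hy.2, ← genBinom_natCast] at h
  have h1 : 1 ≤ genBinom ((t - i : ℕ) : ℝ) (q - i) := by
    rw [genBinom_natCast]
    exact_mod_cast Nat.choose_pos (by omega)
  have := le_of_genBinom_le (by omega) h1 h
  push_cast [(hiq.le.trans hqt)] at this
  linarith

/-- The number of cliques containing `I` is at most `binom(x(I) - i, t - i)`. -/
theorem card_cliques_filter_le {H : UniformHypergraph V q} {t i : ℕ} (hiq : i < q) (hqt : q ≤ t)
    {I : Finset V} (hI : I.card = i) {y : ℝ} (hy : H.IsDegreeParam i I y) :
    (((H.cliques t).filter fun T => I ⊆ T).card : ℝ) ≤ genBinom (y - i) (t - i) := by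
  -- Deleting `I` is injective on sets containing it, so counts carry over to the link of `I`.
  have hinj : ∀ A : Finset (Finset V),
      ((A.filter fun T => I ⊆ T).image (· \ I)).card = (A.filter fun T => I ⊆ T).card := by
    intro A
    refine Finset.card_image_of_injOn fun S hS T hT h => ?_
    rw [← Finset.sdiff_union_of_subset (Finset.mem_filter.1 hS).2, h,
      Finset.sdiff_union_of_subset (Finset.mem_filter.1 hT).2]
  rw [← hinj]
  refine card_le_genBinom (m := q - i) (G := (H.edges.filter fun e => I ⊆ e).image (· \ I))
    (by omega) (by omega) ?_ _ ?_ ?_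
  · rw [hinj]
    exact hy.2
  · intro s hs
    obtain ⟨T, hT, rfl⟩ := Finset.mem_image.1 hs
    rw [Finset.mem_filter, mem_cliques] at hT
    rw [Finset.card_sdiff_of_subset hT.2, hT.1.1, hI]
  · intro s hs e he
    obtain ⟨T, hT, rfl⟩ := Finset.mem_image.1 hs
    rw [Finset.mem_filter, mem_cliques] at hT
    rw [Finset.mem_powersetCard, Finset.subset_sdiff] at he
    refine Finset.mem_image.2 ⟨e ∪ I, Finset.mem_filter.2 ⟨hT.1.2 _ ?_ ?_, ?_⟩, ?_⟩
    · exact Finset.union_subset he.1.1 hT.2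
    · rw [Finset.card_union_of_disjoint he.1.2, he.2]
      omega
    · exact Finset.subset_union_right
    · exact Finset.union_sdiff_cancel_right he.1.2

theorem le_maxOverSubsets_of_mem_cliques {H : UniformHypergraph V q} {t i : ℕ} (hiq : i < q)
    (hqt : q ≤ t) {x : Finset V → ℝ} (hx : H.IsDegreeFunction i x) {T : Finset V}
    (hT : T ∈ H.cliques t) : (t : ℝ) ≤ maxOverSubsets i x T := by
  obtain ⟨I, hI⟩ := Finset.powersetCard_nonempty.2
    (show i ≤ T.card by rw [(mem_cliques.1 hT).1]; omega)
  exact (IsDegreeParam.le hiq hqt hT hI (hx I (Finset.mem_powersetCard.1 hI).2)).trans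
    (le_maxOverSubsets hI x)

theorem sum_cliqueWeight_le {H : UniformHypergraph V q} {t i : ℕ} (hiq : i < q)
    (hqt : q ≤ t) {x : Finset V → ℝ} (hx : H.IsDegreeFunction i x) :
    ∑ T ∈ H.cliques t, cliqueWeight i t (maxOverSubsets i x T) ≤
      ((Fintype.card V).choose i : ℝ) / (t.choose i : ℝ) := by
  have hti : (0 : ℝ) < t.choose i := by exact_mod_cast Nat.choose_pos (by omega)
  rw [le_div_iff₀ hti, Finset.sum_mul]
  calc ∑ T ∈ H.cliques t, cliqueWeight i t (maxOverSubsets i x T) * t.choose i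
      ≤ ∑ T ∈ H.cliques t, ∑ I ∈ T.powersetCard i, cliqueWeight i t (x I) := by
        refine Finset.sum_le_sum fun T hT => ?_
        rw [mul_comm, ← nsmul_eq_mul, ← (mem_cliques.1 hT).1, ← Finset.card_powersetCard,
          (mem_cliques.1 hT).1]
        refine Finset.card_nsmul_le_sum _ _ _ fun I hI => ?_
        have hIt := IsDegreeParam.le hiq hqt hT hI (hx I (Finset.mem_powersetCard.1 hI).2)
        exact (cliqueWeight_strictAntiOn (hiq.trans_le hqt)).antitoneOn hIt
          (le_maxOverSubsets_of_mem_cliques hiq hqt hx hT) (le_maxOverSubsets hI x)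
    _ = ∑ I ∈ Finset.univ.powersetCard i,
          (((H.cliques t).filter fun T => I ⊆ T).card : ℝ) * cliqueWeight i t (x I) :=
        sum_sum_powersetCard i _ _
    _ ≤ ∑ I ∈ (Finset.univ : Finset V).powersetCard i, (1 : ℝ) := by
        refine Finset.sum_le_sum fun I hI => ?_
        have hIi := (Finset.mem_powersetCard.1 hI).2
        rw [cliqueWeight, mul_one_div]
        -- This also covers a zero denominator, where the quotient is 0 by convention.
        exact div_le_one_of_le₀ (card_cliques_filter_le hiq hqt hIi (hx I hIi))
          (genBinom_nonneg _ _)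
    _ = ((Fintype.card V).choose i : ℝ) := by simp

end UniformHypergraph

/-! ### Shadows of Steiner systems -/

theorem mem_edges_qShadow {V : Type*} [DecidableEq V] {q : ℕ} {B : Finset (Finset V)}
    {e : Finset V} : e ∈ (qShadow q B).edges ↔ ∃ b ∈ B, e ⊆ b ∧ e.card = q := by
  simp [qShadow, Finset.mem_powersetCard]

namespace IsSteinerSystem

variable {V : Type*} {i r q t : ℕ} {B : Finset (Finset V)}

/-- Any `i` points of `A` already determine the block. -/
theorem eq_of_subset (hB : IsSteinerSystem i r B) {A b b' : Finset V} (hA : i ≤ A.card)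
    (hb : b ∈ B) (hb' : b' ∈ B) (hAb : A ⊆ b) (hAb' : A ⊆ b') : b = b' := by
  obtain ⟨I, hIA, hI⟩ := Finset.exists_subset_card_eq hA
  exact (hB.2 I hI).unique ⟨hb, hIA.trans hAb⟩ ⟨hb', hIA.trans hAb'⟩

/-- For `t ≥ q > i`, the `t`-cliques of the shadow are the `t`-subsets of the blocks. -/
theorem mem_cliques_qShadow [DecidableEq V] [Fintype V]
    (hB : IsSteinerSystem i r B) (hiq : i < q) (hqt : q ≤ t)
    {T : Finset V} : T ∈ (qShadow q B).cliques t ↔ T.card = t ∧ ∃ b ∈ B, T ⊆ b := by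
  rw [UniformHypergraph.mem_cliques]
  refine and_congr_right fun hT => ⟨fun h => ?_, ?_⟩
  · obtain ⟨e, heT, he⟩ := Finset.exists_subset_card_eq (hqt.trans hT.ge)
    obtain ⟨b, hb, heb, -⟩ := mem_edges_qShadow.1 (h e heT he)
    refine ⟨b, hb, fun v hv => ?_⟩
    -- For `v` outside `e`, replace one point of `e` by `v`. The new edge shares `q - 1 ≥ i` points
    -- with `e`, hence lies in the same block.
    by_cases hve : v ∈ e
    · exact heb hve
    obtain ⟨J, hJe, hJ⟩ := Finset.exists_subset_card_eq (show q - 1 ≤ e.card by omega)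
    have hJv : (insert v J).card = q := by
      rw [Finset.card_insert_of_notMem fun hvJ => hve (hJe hvJ)]
      omega
    obtain ⟨b', hb', hJb', -⟩ := mem_edges_qShadow.1
      (h _ (Finset.insert_subset hv (hJe.trans heT)) hJv)
    rw [hB.eq_of_subset (show i ≤ J.card by omega) hb hb' (hJe.trans heb)
      ((Finset.subset_insert _ _).trans hJb')]
    exact hJb' (Finset.mem_insert_self _ _)
  · rintro ⟨b, hb, hTb⟩ e heT he
    exact mem_edges_qShadow.2 ⟨b, hb, heT.trans hTb, he⟩

/-- The `k`-subsets of blocks that contain a given `i`-set `I` number `binom(r - i, k - i)`. -/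
theorem card_filter_superset [DecidableEq V] (hB : IsSteinerSystem i r B) {k : ℕ} (hik : i ≤ k)
    {A : Finset (Finset V)} (hA : ∀ e, e ∈ A ↔ e.card = k ∧ ∃ b ∈ B, e ⊆ b) {I : Finset V}
    (hI : I.card = i) : (A.filter fun e => I ⊆ e).card = (r - i).choose (k - i) := by
  obtain ⟨b, ⟨hb, hIb⟩, -⟩ := hB.2 I hI
  rw [← hB.1 b hb, ← hI, ← Finset.card_filter_powersetCard_subset _ _ _ hIb (hI.trans_le hik)]
  congr 1
  ext e
  simp only [Finset.mem_filter, hA, Finset.mem_powersetCard]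
  refine and_congr_left fun hIe => ⟨?_, fun h => ⟨h.2, b, hb, h.1⟩⟩
  rintro ⟨he, b', hb', heb'⟩
  rw [hB.eq_of_subset hI.ge hb hb' hIb (hIe.trans heb')]
  exact ⟨heb', he⟩

theorem eq_of_isDegreeParam [DecidableEq V] (hB : IsSteinerSystem i r B)
    (hiq : i < q) (hqr : q ≤ r)
    {I : Finset V} (hI : I.card = i) {y : ℝ} (hy : (qShadow q B).IsDegreeParam i I y) :
    y = r := by
  have hd : (qShadow q B).degree I = (r - i).choose (q - i) :=
    hB.card_filter_superset hiq.le
      (fun e => by rw [mem_edges_qShadow]; exact ⟨fun ⟨b, h⟩ => ⟨h.2.2, b, h.1, h.2.1⟩,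
        fun ⟨h, b, h'⟩ => ⟨b, h'.1, h'.2, h⟩⟩) hI
  refine UniformHypergraph.IsDegreeParam.eq hiq ?_ hy ⟨?_, ?_⟩
  · rw [hd]
    exact Nat.choose_pos (by omega)
  · have : (q : ℝ) ≤ r := by exact_mod_cast hqr
    linarith [(i.cast_nonneg : (0 : ℝ) ≤ i)]
  · rw [hd, ← genBinom_natCast]
    push_cast [hiq.le.trans hqr]
    rfl

theorem attainsBound [DecidableEq V] [Fintype V]
    (hB : IsSteinerSystem i r B) (hiq : i < q) (hqt : q ≤ t)
    (htr : t ≤ r) : (qShadow q B).AttainsBound i t := by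
  intro x hx
  have hti : (0 : ℝ) < t.choose i := by exact_mod_cast Nat.choose_pos (by omega)
  have hxr : ∀ I : Finset V, I.card = i → x I = r := fun I hI =>
    hB.eq_of_isDegreeParam hiq (hqt.trans htr) hI (hx I hI)
  rw [eq_div_iff hti.ne', Finset.sum_mul]
  calc ∑ T ∈ (qShadow q B).cliques t, cliqueWeight i t (maxOverSubsets i x T) * t.choose i
      = ∑ T ∈ (qShadow q B).cliques t, ∑ I ∈ T.powersetCard i, cliqueWeight i t r := by
        refine Finset.sum_congr rfl fun T hT => ?_
        have hTt := (UniformHypergraph.mem_cliques.1 hT).1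
        rw [maxOverSubsets_eq_of_forall (by omega)
          fun I hI => hxr I (Finset.mem_powersetCard.1 hI).2]
        simp [hTt, mul_comm]
    _ = ∑ I ∈ Finset.univ.powersetCard i,
          ((((qShadow q B).cliques t).filter fun T => I ⊆ T).card : ℝ) * cliqueWeight i t r :=
        sum_sum_powersetCard i _ _
    _ = ∑ I ∈ (Finset.univ : Finset V).powersetCard i, (1 : ℝ) := by
        refine Finset.sum_congr rfl fun I hI => ?_
        rw [hB.card_filter_superset (hiq.le.trans hqt)
          (fun T => hB.mem_cliques_qShadow hiq hqt) (Finset.mem_powersetCard.1 hI).2,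
          ← genBinom_natCast, cliqueWeight]
        have hpos := genBinom_sub_pos (hiq.le.trans hqt) (y := r) (by exact_mod_cast htr)
        push_cast [hiq.le.trans (hqt.trans htr)]
        exact mul_one_div_cancel hpos.ne'
    _ = ((Fintype.card V).choose i : ℝ) := by simp

end IsSteinerSystem

/-- The family whose only block is the whole vertex set is a Steiner system `S(i, n, n)`. -/
theorem isSteinerSystem_univ {V : Type*} [Fintype V] (i : ℕ) :
    IsSteinerSystem i (Fintype.card V) ({Finset.univ} : Finset (Finset V)) := by
  refine ⟨fun b hb => by rw [Finset.mem_singleton.1 hb, Finset.card_univ], fun I _ => ?_⟩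
  exact ⟨Finset.univ, by simp, fun b hb => Finset.mem_singleton.1 hb.1⟩

theorem mainTheorem6 (t q i : ℕ) (hi : 1 ≤ i) (hiq : i < q) (hqt : q ≤ t) :
    -- the weight, as a function of `x(T)`, is well-defined and decreasing on `[t, ∞)`
    (∀ y : ℝ, (t : ℝ) ≤ y → 0 < genBinom (y - i) (t - i)) ∧
    StrictAntiOn (cliqueWeight i t) (Set.Ici (t : ℝ)) ∧
    (∀ (V : Type*) [DecidableEq V] [Fintype V] (H : UniformHypergraph V q),
      -- `x(I)` exists, and it is unique if some edge contains `I`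
      (∀ I : Finset V, I.card = i → ∃ y : ℝ, H.IsDegreeParam i I y) ∧
      (∀ I : Finset V, I.card = i → 0 < H.degree I → ∃! y : ℝ, H.IsDegreeParam i I y) ∧
      -- `x(T)` does not depend on the choice of the `x(I)`
      (∀ x x' : Finset V → ℝ, H.IsDegreeFunction i x → H.IsDegreeFunction i x' →
        ∀ T ∈ H.cliques t, maxOverSubsets i x T = maxOverSubsets i x' T) ∧
      (∀ x : Finset V → ℝ, H.IsDegreeFunction i x →
        (∀ T ∈ H.cliques t, (t : ℝ) ≤ maxOverSubsets i x T) ∧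
        ∑ T ∈ H.cliques t, cliqueWeight i t (maxOverSubsets i x T) ≤
          ((Fintype.card V).choose i : ℝ) / (t.choose i : ℝ))) ∧
    -- shadows of Steiner systems with blocks of size at least `t` attain the bound
    (∀ (V : Type*) [DecidableEq V] [Fintype V] (r : ℕ) (B : Finset (Finset V)),
      t ≤ r → IsSteinerSystem i r B → (qShadow q B).AttainsBound i t) ∧
    -- the bound is attained for infinitely many numbers of vertices
    {n : ℕ | ∃ H : UniformHypergraph (Fin n) q, H.AttainsBound i t}.Infinite := by
  have hit : i < t := hiq.trans_le hqt
  refine ⟨fun y hy => genBinom_sub_pos hit.le hy, cliqueWeight_strictAntiOn hit,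
    fun V _ _ H => ⟨fun I _ => H.exists_isDegreeParam hiq I, fun I _ hd => ?_,
      fun x x' hx hx' T hT => ?_, fun x hx => ⟨fun T hT => ?_, ?_⟩⟩,
    fun V _ _ r B htr hB => hB.attainsBound hiq hqt htr, ?_⟩
  · obtain ⟨y, hy⟩ := H.exists_isDegreeParam hiq I
    exact ⟨y, hy, fun z hz => UniformHypergraph.IsDegreeParam.eq hiq hd hz hy⟩
  · refine maxOverSubsets_congr fun I hI => ?_
    have hIi := (Finset.mem_powersetCard.1 hI).2
    exact UniformHypergraph.IsDegreeParam.eq hiq (UniformHypergraph.degree_pos hiq hqt hT hI)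
      (hx I hIi) (hx' I hIi)
  · exact UniformHypergraph.le_maxOverSubsets_of_mem_cliques hiq hqt hx hT
  · exact UniformHypergraph.sum_cliqueWeight_le hiq hqt hx
  -- With the whole vertex set as the only block, the shadow is the complete hypergraph on `n ≥ t`
  -- vertices.
  · refine (Set.Ici_infinite t).mono fun n hn => ⟨qShadow q {Finset.univ}, ?_⟩
    refine (isSteinerSystem_univ (V := Fin n) i).attainsBound hiq hqt ?_
    rw [Fintype.card_fin]
    exact hn
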